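/- All graphs are finite, simple and have at least one vertex. A set $S$ of vertices of a graph $G$ is dominating if every vertex of $G$ lies in $S$ or is adjacent to a vertex of $S$. An independent coalition in $G$ consists of two disjoint independent sets of vertices, neither of which is an independent dominating set but whose union is an independent dominating set. An $ic$-partition of $G$ is a partition $\pi$ of $V(G)$ into nonempty classes such that each class is either a singleton dominating set, or is not an independent dominating set but forms an independent coalition with another class of $\pi$. $IC(G)$ is the maximum number of classes of an $ic$-partition of $G$ (the equation $IC(G)=n$ includes the assertion that an $ic$-partition exists). $P_m$, $C_m$ and $K_m$ denote the path, cycle and complete graph on $m$ vertices, $\overline{G}$ the complement of $G$, and $\cup$ disjoint union. Let $\mathcal{K}_0$ be the bipartite graph with partite sets $\{v_1,v_2,v_3,v_4\}$ and $\{u_1,u_2,u_3,u_4\}$ in which $v_i$ is adjacent to $u_j$ if and only if $i\neq j$. Let $\mathcal{K}$ be the family of graphs, one for each integer $k\ge 1$, whose vertex set is the disjoint union of the independent sets $H_1=\{v_1,\dots,v_4\}$, $H_2=\{u_1,\dots,u_4\}$, $H_3=\{n_1,\dots,n_k\}$ and $H_4=\{m_1,\dots,m_k\}$, such that: every vertex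 of $H_1$ is adjacent to every vertex of $H_3$, and every vertex of $H_2$ to every vertex of $H_4$; there are no edges between $H_1$ and $H_4$, and none between $H_2$ and $H_3$; $v_i$ is adjacent to $u_j$ if and only if $i\ne j$; and $n_i$ is adjacent to $m_j$ if and only if $i\neq j$. **Corollary.** Let $G$ be a triangle-free graph of order $n$. Then $IC(G)=n$ if and only if $G$ is isomorphic to one of $C_4$, $C_5$, $C_6$, $P_1$, $P_2$, $P_3$, $P_4$, $\overline{K}_2$, $K_1\cup K_2$, $K_2\cup K_2$, $\mathcal{K}_0$, or to a member of the family $\mathcal{K}$. -/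

import Mathlib

open SimpleGraph

section IndependentCoalitions

variable {V : Type*}

/-- `S` is a dominating set of `G`: every vertex is in `S` or adjacent to an element of `S`. -/
def IsDomSet (G : SimpleGraph V) (S : Finset V) : Prop :=
  ∀ v : V, v ∈ S ∨ ∃ u ∈ S, G.Adj v u

/-- `S` is an independent dominating set of `G`. -/
def IsIndepDomSet (G : SimpleGraph V) (S : Finset V) : Prop :=
  G.IsIndepSet (S : Set V) ∧ IsDomSet G S

variable [DecidableEq V]

/-- `A` and `B` form an independent coalition in `G`: they are disjoint independent sets, neither
of which is an independent dominating set, but whose union is an independent dominating set. -/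
def IsIndepCoalition (G : SimpleGraph V) (A B : Finset V) : Prop :=
  Disjoint A B ∧ G.IsIndepSet (A : Set V) ∧ G.IsIndepSet (B : Set V) ∧
    ¬ IsIndepDomSet G A ∧ ¬ IsIndepDomSet G B ∧ IsIndepDomSet G (A ∪ B)

variable [Fintype V]

/-- The vertex partition `π` is an independent coalition partition of `G`: each class is a
singleton dominating set, or is not an independent dominating set but forms an independent
coalition with another class. -/
def IsICPartition (G : SimpleGraph V) (π : Finpartition (Finset.univ : Finset V)) : Prop :=
  ∀ A ∈ π.parts,
    (A.card = 1 ∧ IsDomSet G A) ∨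
    (¬ IsIndepDomSet G A ∧ ∃ B ∈ π.parts, B ≠ A ∧ IsIndepCoalition G A B)

/-- `IC(G) = k`: the maximum number of classes of an independent coalition partition of `G` exists
and equals `k`.  (If `G` has no such partition, then `IC(G) = k` holds for no `k`.) -/
def ICNumberEq (G : SimpleGraph V) (k : ℕ) : Prop :=
  IsGreatest {m : ℕ | ∃ π : Finpartition (Finset.univ : Finset V),
    IsICPartition G π ∧ π.parts.card = m} k

end IndependentCoalitions

/-- The bipartite graph with partite sets `{v₁,…,v₄}` (left) and `{u₁,…,u₄}` (right) in which
`vᵢ` is adjacent to `uⱼ` exactly when `i ≠ j`. -/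
def graphK0 : SimpleGraph (Fin 4 ⊕ Fin 4) where
  Adj
    | .inl i, .inr j => i ≠ j
    | .inr j, .inl i => i ≠ j
    | _, _ => False
  symm := ⟨by rintro (i | i) (j | j) h <;> exact h⟩
  loopless := ⟨by rintro (i | i) h <;> exact h⟩

/-- The member with parameter `k` of the family `𝒦`.  Its partite sets are
`H₁ = {v₁,…,v₄}` (`inl (inl i)`), `H₂ = {u₁,…,u₄}` (`inl (inr i)`),
`H₃ = {n₁,…,n_k}` (`inr (inl i)`) and `H₄ = {m₁,…,m_k}` (`inr (inr i)`); `[H₁,H₃]` and `[H₂,H₄]`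
are full, `[H₁,H₄]` and `[H₂,H₃]` are empty, `vᵢ ~ uⱼ` iff `i ≠ j`, and `nᵢ ~ mⱼ` iff `i ≠ j`. -/
def graphK (k : ℕ) : SimpleGraph ((Fin 4 ⊕ Fin 4) ⊕ (Fin k ⊕ Fin k)) where
  Adj
    | .inl (.inl i), .inl (.inr j) => i ≠ j
    | .inl (.inr j), .inl (.inl i) => i ≠ j
    | .inr (.inl i), .inr (.inr j) => i ≠ j
    | .inr (.inr j), .inr (.inl i) => i ≠ j
    | .inl (.inl _), .inr (.inl _) => True
    | .inr (.inl _), .inl (.inl _) => True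
    | .inl (.inr _), .inr (.inr _) => True
    | .inr (.inr _), .inl (.inr _) => True
    | _, _ => False
  symm := ⟨by rintro ((i | i) | (i | i)) ((j | j) | (j | j)) h <;> exact h⟩
  loopless := ⟨by rintro ((i | i) | (i | i)) h <;> exact h⟩

/-! A partition with as many classes as vertices consists of singletons, so the equation says that
every vertex is universal or has a dominating partner (`icNumberEq_card_iff`). The triangle-free
graphs with this property fall into three cases. With a universal vertex the graph is a star, and
the partner of a leaf leaves room for at most two leaves: P1, P2, P3. If there is no universal
vertex and some dominating pair v, w has a common neighbour x, then triangle-freeness makes v and w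
the only neighbours of x. The partner of x then yields C4, P4 or C5
(`isListed_of_common_neighbor_aux`). If no dominating pair has a common neighbour, then N(w) with v
and N(v) with w are the sides of a bipartition. Except in K1 ∪ K2, non-adjacency across it is a
perfect matching (`exists_partner_adj`), so the graph is a crown. Crowns on 2m vertices are the
complement of K2, 2K2, C6 and `graphK0` for m = 1, 2, 3, 4, and `graphK (m - 4)` for m ≥ 5. -/

/-- Every vertex is universal or forms a dominating pair with a vertex not adjacent to it. -/
def HasDominatingPartners {V : Type*} (G : SimpleGraph V) : Prop :=
  ∀ v, (∀ u, u ≠ v → G.Adj u v) ∨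
    ∃ w, w ≠ v ∧ ¬ G.Adj v w ∧ ∀ u, u = v ∨ u = w ∨ G.Adj u v ∨ G.Adj u w

instance {V : Type*} [Fintype V] [DecidableEq V] (G : SimpleGraph V) [DecidableRel G.Adj] :
    Decidable (HasDominatingPartners G) := by
  unfold HasDominatingPartners; infer_instance

theorem HasDominatingPartners.of_iso {V W : Type*} {G : SimpleGraph V} {H : SimpleGraph W}
    (e : G ≃g H) (h : HasDominatingPartners H) : HasDominatingPartners G := by
  intro v
  rcases h (e v) with h | ⟨w, h1, h2, h3⟩
  · left
    intro u hu
    exact e.map_adj_iff.1 (h (e u) (fun h => hu (e.injective h)))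
  · obtain ⟨w, rfl⟩ := e.surjective w
    refine Or.inr ⟨w, fun h => h1 (h ▸ rfl), fun h => h2 (e.map_adj_iff.2 h), fun u => ?_⟩
    simpa only [e.map_adj_iff, e.injective.eq_iff] using h3 (e u)

/-! ### Reduction to singleton classes -/

theorem isDomSet_singleton_iff {V : Type*} {G : SimpleGraph V} {v : V} :
    IsDomSet G {v} ↔ ∀ u, u ≠ v → G.Adj u v := by
  simp only [IsDomSet, Finset.mem_singleton, exists_eq_left, or_iff_not_imp_left, ne_eq]

theorem isIndepDomSet_singleton_iff {V : Type*} {G : SimpleGraph V} {v : V} :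
    IsIndepDomSet G {v} ↔ ∀ u, u ≠ v → G.Adj u v := by
  simp [IsIndepDomSet, isDomSet_singleton_iff, SimpleGraph.IsIndepSet]

/-- Non-adjacency of the pair already prevents either singleton from dominating, so those clauses of
the definition are automatic. -/
theorem isIndepCoalition_singletons_iff {V : Type*} [DecidableEq V] {G : SimpleGraph V} {v w : V} :
    IsIndepCoalition G {v} {w} ↔
      w ≠ v ∧ ¬ G.Adj v w ∧ ∀ u, u = v ∨ u = w ∨ G.Adj u v ∨ G.Adj u w := by
  constructor
  · rintro ⟨h1, -, -, -, -, h2, h3⟩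
    have hne : v ≠ w := by simpa using h1
    refine ⟨hne.symm, h2 (by simp) (by simp) hne, fun u => ?_⟩
    simpa [or_assoc] using h3 u
  · rintro ⟨h1, h2, h3⟩
    refine ⟨by simpa using h1.symm, by simp [SimpleGraph.IsIndepSet],
      by simp [SimpleGraph.IsIndepSet], ?_, ?_, ?_, ?_⟩
    · rw [isIndepDomSet_singleton_iff]
      exact fun h => h2 (h w h1).symm
    · rw [isIndepDomSet_singleton_iff]
      exact fun h => h2 (h v h1.symm)
    · intro a ha b hb hab
      simp only [Finset.coe_union, Finset.coe_singleton, Set.mem_union, Set.mem_singleton_iff]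
        at ha hb
      rcases ha with rfl | rfl <;> rcases hb with rfl | rfl
      · exact absurd rfl hab
      · exact h2
      · exact fun h => h2 h.symm
      · exact absurd rfl hab
    · intro u
      simpa [or_assoc] using h3 u

/-- The class sizes are at least 1 and their sum equals the number of classes, so each is 1. -/
theorem Finpartition.card_eq_one_of_card_parts_eq {V : Type*} [Fintype V] [DecidableEq V]
    (π : Finpartition (Finset.univ : Finset V)) (h : π.parts.card = Fintype.card V)
    {A : Finset V} (hA : A ∈ π.parts) : A.card = 1 := by
  have hs : ∑ B ∈ π.parts, 1 = ∑ B ∈ π.parts, B.card := by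
    rw [π.sum_card_parts, Finset.sum_const, smul_eq_mul, mul_one, h, Finset.card_univ]
  have hle : ∀ B ∈ π.parts, 1 ≤ B.card := fun B hB =>
    Finset.card_pos.2 (π.nonempty_of_mem_parts hB)
  exact (((Finset.sum_eq_sum_iff_of_le hle).1 hs) A hA).symm

theorem icNumberEq_card_iff {V : Type*} [Fintype V] [DecidableEq V] (G : SimpleGraph V) :
    ICNumberEq G (Fintype.card V) ↔ HasDominatingPartners G := by
  constructor
  · rintro ⟨⟨π, hπ, hcard⟩, -⟩ v
    have hv : ({v} : Finset V) ∈ π.parts := by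
      obtain ⟨A, hA, hvA⟩ := π.exists_mem (Finset.mem_univ v)
      obtain ⟨a, rfl⟩ := Finset.card_eq_one.1 (π.card_eq_one_of_card_parts_eq hcard hA)
      rwa [Finset.mem_singleton.1 hvA]
    rcases hπ _ hv with ⟨-, h⟩ | ⟨-, B, hB, -, h⟩
    · exact Or.inl (isDomSet_singleton_iff.1 h)
    · obtain ⟨w, rfl⟩ := Finset.card_eq_one.1 (π.card_eq_one_of_card_parts_eq hcard hB)
      exact Or.inr ⟨w, isIndepCoalition_singletons_iff.1 h⟩
  · intro h
    refine ⟨⟨⊥, ?_, by rw [Finpartition.card_bot, Finset.card_univ]⟩, ?_⟩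
    · intro A hA
      obtain ⟨v, -, rfl⟩ := Finpartition.mem_bot_iff.1 hA
      rcases h v with h | ⟨w, h⟩
      · exact Or.inl ⟨Finset.card_singleton v, isDomSet_singleton_iff.2 h⟩
      · have hc := isIndepCoalition_singletons_iff.2 h
        refine Or.inr ⟨hc.2.2.2.1, {w}, Finpartition.mem_bot_iff.2 ⟨w, Finset.mem_univ w, rfl⟩,
          ?_, hc⟩
        simpa using h.1
    · rintro m ⟨π, -, rfl⟩
      exact π.card_parts_le_card.trans_eq Finset.card_univ

/-! ### Crown graphs -/

/-- The complete bipartite graph on two copies of `α` with the perfect matching removed. -/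
def crownGraph (α : Type*) : SimpleGraph (α ⊕ α) where
  Adj
    | .inl i, .inr j => i ≠ j
    | .inr j, .inl i => i ≠ j
    | _, _ => False
  symm := ⟨by rintro (i | i) (j | j) h <;> exact h⟩
  loopless := ⟨by rintro (i | i) h <;> exact h⟩

theorem hasDominatingPartners_crownGraph (α : Type*) : HasDominatingPartners (crownGraph α) := by
  rintro (i | i)
  · refine Or.inr ⟨.inr i, by simp, fun h => h rfl, ?_⟩
    rintro (j | j) <;> by_cases h : j = i <;> simp [crownGraph, h, eq_comm]
  · refine Or.inr ⟨.inl i, by simp, fun h => h rfl, ?_⟩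
    rintro (j | j) <;> by_cases h : j = i <;> simp [crownGraph, h, eq_comm]

/-- Crown graphs over equivalent types are isomorphic. -/
def crownGraphCongr {α β : Type*} (e : α ≃ β) : crownGraph α ≃g crownGraph β where
  toEquiv := Equiv.sumCongr e e
  map_rel_iff' := by
    rintro (i | i) (j | j) <;> simp [crownGraph]

/-- The graphs of the family `graphK` are crown graphs. -/
def crownGraphIsoGraphK (k : ℕ) : crownGraph (Fin 4 ⊕ Fin k) ≃g graphK k where
  -- The sides of the bipartition are H₁ ∪ H₄ and H₂ ∪ H₃, so the m's join the v's and the n's join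
  -- the u's.
  toFun
    | .inl (.inl i) => .inl (.inl i)
    | .inl (.inr j) => .inr (.inr j)
    | .inr (.inl i) => .inl (.inr i)
    | .inr (.inr j) => .inr (.inl j)
  invFun
    | .inl (.inl i) => .inl (.inl i)
    | .inr (.inr j) => .inl (.inr j)
    | .inl (.inr i) => .inr (.inl i)
    | .inr (.inl j) => .inr (.inr j)
  left_inv := by rintro ((i | i) | (i | i)) <;> rfl
  right_inv := by rintro ((i | i) | (i | i)) <;> rfl
  map_rel_iff' := by
    rintro ((i | i) | (i | i)) ((j | j) | (j | j)) <;> simp [crownGraph, graphK, eq_comm]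

theorem crownGraph_fin_four : crownGraph (Fin 4) = graphK0 := by
  ext a b
  rcases a with i | i <;> rcases b with j | j <;> rfl

theorem nonempty_iso_of_bijective {V W : Type*} {G : SimpleGraph V} {H : SimpleGraph W}
    (f : W → V) (hf : Function.Bijective f) (h : ∀ a b, G.Adj (f a) (f b) ↔ H.Adj a b) :
    Nonempty (G ≃g H) :=
  ⟨RelIso.symm { toEquiv := Equiv.ofBijective f hf, map_rel_iff' := h _ _ }⟩

/-- Each vertex outside `P` takes the label of its unique non-neighbour in `P`. -/
theorem nonempty_iso_crownGraph {V : Type*} {G : SimpleGraph V} (P : V → Prop)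
    (h1 : ∀ x y, P x → P y → ¬ G.Adj x y) (h2 : ∀ x y, ¬ P x → ¬ P y → ¬ G.Adj x y)
    (h3 : ∀ x, P x → ∃! y, ¬ P y ∧ ¬ G.Adj x y)
    (h4 : ∀ x, ¬ P x → ∃! y, P y ∧ ¬ G.Adj x y) :
    Nonempty (G ≃g crownGraph {x // P x}) := by
  choose f hf hu using fun x : {x // P x} => h3 x.1 x.2
  simp only at hf hu
  have hinj : ∀ x y, f x = f y → x = y := by
    intro x y hxy
    refine Subtype.ext ((h4 (f x) (hf x).1).unique ⟨x.2, fun h => (hf x).2 h.symm⟩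
      ⟨y.2, fun h => (hf y).2 (hxy ▸ h.symm)⟩)
  refine nonempty_iso_of_bijective (Sum.elim (fun x => x.1) f) ⟨?_, ?_⟩ ?_
  · rintro (x | x) (y | y) h
    · exact congrArg _ (Subtype.ext h)
    · have h : x.1 = f y := h
      exact absurd x.2 (h ▸ (hf y).1)
    · have h : f x = y.1 := h
      exact absurd y.2 (h ▸ (hf x).1)
    · exact congrArg _ (hinj x y h)
  · intro y
    by_cases hy : P y
    · exact ⟨.inl ⟨y, hy⟩, rfl⟩
    · obtain ⟨x, ⟨hx, hxy⟩, -⟩ := h4 y hy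
      exact ⟨.inr ⟨x, hx⟩, (hu ⟨x, hx⟩ y ⟨hy, fun h => hxy h.symm⟩).symm⟩
  · have key : ∀ x y, G.Adj x.1 (f y) ↔ x ≠ y := by
      intro x y
      constructor
      · rintro h rfl
        exact (hf x).2 h
      · intro h
        by_contra hn
        exact h (hinj x y (hu x (f y) ⟨(hf y).1, hn⟩).symm)
    rintro (x | x) (y | y)
    · exact iff_of_false (h1 _ _ x.2 y.2) id
    · exact key x y
    · exact (G.adj_comm _ _).trans (key y x)
    · exact iff_of_false (h2 _ _ (hf x).1 (hf y).1) id

/-! ### The list of graphs -/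

/-- The triangle-free graphs in which every vertex is universal or has a dominating partner. -/
def IsListed {V : Type*} (G : SimpleGraph V) : Prop :=
  Nonempty (G ≃g cycleGraph 4) ∨ Nonempty (G ≃g cycleGraph 5) ∨
    Nonempty (G ≃g cycleGraph 6) ∨
    Nonempty (G ≃g pathGraph 1) ∨ Nonempty (G ≃g pathGraph 2) ∨
    Nonempty (G ≃g pathGraph 3) ∨ Nonempty (G ≃g pathGraph 4) ∨
    Nonempty (G ≃g (completeGraph (Fin 2))ᶜ) ∨
    Nonempty (G ≃g (completeGraph (Fin 1) ⊕g completeGraph (Fin 2))) ∨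
    Nonempty (G ≃g (completeGraph (Fin 2) ⊕g completeGraph (Fin 2))) ∨
    Nonempty (G ≃g graphK0) ∨
    ∃ k : ℕ, 1 ≤ k ∧ Nonempty (G ≃g graphK k)

theorem HasDominatingPartners.of_isListed {V : Type*} {G : SimpleGraph V} (h : IsListed G) :
    HasDominatingPartners G := by
  rcases h with ⟨⟨e⟩⟩ | ⟨⟨e⟩⟩ | ⟨⟨e⟩⟩ | ⟨⟨e⟩⟩ | ⟨⟨e⟩⟩ | ⟨⟨e⟩⟩ | ⟨⟨e⟩⟩ | ⟨⟨e⟩⟩ | ⟨⟨e⟩⟩ | ⟨⟨e⟩⟩ |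
    ⟨⟨e⟩⟩ | ⟨k, -, ⟨e⟩⟩
  · exact .of_iso e (by decide)
  · exact .of_iso e (by decide)
  · exact .of_iso e (by decide)
  · exact .of_iso e (by simp [HasDominatingPartners, pathGraph_adj])
  · exact .of_iso e (by simp [HasDominatingPartners, pathGraph_adj, Fin.forall_fin_succ])
  · exact .of_iso e (by simp [HasDominatingPartners, pathGraph_adj, Fin.forall_fin_succ, Fin.exists_fin_succ])
  · exact .of_iso e (by simp [HasDominatingPartners, pathGraph_adj, Fin.forall_fin_succ, Fin.exists_fin_succ])
  · exact .of_iso e (by decide)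
  · exact .of_iso e (by simp [HasDominatingPartners, Fin.forall_fin_succ, Fin.exists_fin_succ])
  · exact .of_iso e (by simp [HasDominatingPartners, Fin.forall_fin_succ, Fin.exists_fin_succ])
  · exact .of_iso e (crownGraph_fin_four ▸ hasDominatingPartners_crownGraph _)
  · exact .of_iso (e.trans (crownGraphIsoGraphK k).symm) (hasDominatingPartners_crownGraph _)

theorem isListed_of_iso_crownGraph {V α : Type*} [Finite α] [Nonempty α] {G : SimpleGraph V}
    (e : G ≃g crownGraph α) : IsListed G := by
  have hpos : 0 < Nat.card α := Nat.card_pos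
  generalize hm : Nat.card α = m at hpos
  have e' : G ≃g crownGraph (Fin m) := e.trans (crownGraphCongr (Finite.equivFinOfCardEq hm))
  clear hm e
  unfold IsListed
  match m with
  | 1 =>
    obtain ⟨f⟩ : Nonempty (crownGraph (Fin 1) ≃g (completeGraph (Fin 2))ᶜ) :=
      nonempty_iso_of_bijective ![.inl 0, .inr 0] (by decide)
        (by simp [Fin.forall_fin_succ, crownGraph])
    have := Nonempty.intro (e'.trans f)
    tauto
  | 2 =>
    obtain ⟨f⟩ : Nonempty (crownGraph (Fin 2) ≃g (completeGraph (Fin 2) ⊕g completeGraph (Fin 2))) :=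
      nonempty_iso_of_bijective (Sum.elim ![.inl 0, .inr 1] ![.inl 1, .inr 0]) (by decide)
        (by simp [Fin.forall_fin_succ, crownGraph])
    have := Nonempty.intro (e'.trans f)
    tauto
  | 3 =>
    obtain ⟨f⟩ : Nonempty (crownGraph (Fin 3) ≃g cycleGraph 6) :=
      -- Opposite vertices of the hexagon are the deleted matching pairs.
      nonempty_iso_of_bijective ![.inl 0, .inr 1, .inl 2, .inr 0, .inl 1, .inr 2] (by decide)
        (by simp [Fin.forall_fin_succ, crownGraph, cycleGraph_adj]; decide)
    have := Nonempty.intro (e'.trans f)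
    tauto
  | 4 =>
    have := Nonempty.intro (crownGraph_fin_four ▸ e')
    tauto
  | k + 5 =>
    have f : crownGraph (Fin (k + 5)) ≃g crownGraph (Fin 4 ⊕ Fin (k + 1)) :=
      crownGraphCongr ((finCongr (by omega)).trans finSumFinEquiv.symm)
    have : ∃ k : ℕ, 1 ≤ k ∧ Nonempty (G ≃g graphK k) :=
      ⟨k + 1, by omega, ⟨(e'.trans f).trans (crownGraphIsoGraphK _)⟩⟩
    tauto

/-! ### A universal vertex -/

theorem isListed_of_universal {V : Type*} {G : SimpleGraph V}
    (hT : ∀ a b c, G.Adj a b → G.Adj b c → ¬ G.Adj a c) (hG : HasDominatingPartners G)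
    {v : V} (hv : ∀ u, u ≠ v → G.Adj u v) : IsListed G := by
  have hind : ∀ a b, a ≠ v → b ≠ v → ¬ G.Adj a b := fun a b ha hb h =>
    hT a b v h (hv b hb) (hv a ha)
  unfold IsListed
  by_cases h1 : ∀ u, u = v
  · have : Nonempty (G ≃g pathGraph 1) :=
      nonempty_iso_of_bijective ![v] ⟨fun _ _ _ => Subsingleton.elim _ _, fun u => ⟨0, (h1 u).symm⟩⟩
        (by simp [Fin.forall_fin_succ])
    tauto
  push Not at h1
  obtain ⟨a, ha⟩ := h1
  have hav := hv a ha
  by_cases h2 : ∀ u, u = v ∨ u = a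
  · have : Nonempty (G ≃g pathGraph 2) := by
      refine nonempty_iso_of_bijective ![v, a] ⟨?_, fun u => ?_⟩ ?_
      · simp [Function.Injective, Fin.forall_fin_succ, ha, ha.symm]
      · rcases h2 u with rfl | rfl
        exacts [⟨0, rfl⟩, ⟨1, rfl⟩]
      · simp [Fin.forall_fin_succ, pathGraph_adj, hav, hav.symm]
    tauto
  push Not at h2
  obtain ⟨b, hb, hba⟩ := h2
  have hP : Nonempty (G ≃g pathGraph 3) := by
    -- Leaves are pairwise non-adjacent, so the leaf `a` and its partner `w` can dominate no third
    -- leaf.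
    rcases hG a with h | ⟨w, hwa, haw, h⟩
    · exact absurd (h b hba) (hind b a hb ha)
    · have hw : w ≠ v := fun h => haw (h ▸ hav)
      have hwv := hv w hw
      have haw' : ¬ G.Adj w a := fun h => haw h.symm
      refine nonempty_iso_of_bijective ![a, v, w] ⟨?_, fun u => ?_⟩ ?_
      · simp [Function.Injective, Fin.forall_fin_succ, ha, ha.symm, hw, hw.symm, hwa, hwa.symm]
      · by_cases huv : u = v
        · exact ⟨1, huv.symm⟩
        rcases h u with rfl | rfl | h | h
        · exact ⟨0, rfl⟩
        · exact ⟨2, rfl⟩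
        · exact absurd h (hind _ _ huv ha)
        · exact absurd h (hind _ _ huv hw)
      · simp [Fin.forall_fin_succ, pathGraph_adj, hav, hav.symm, hwv, hwv.symm, haw,
          haw']
  tauto

/-! ### A dominating pair with a common neighbour -/

theorem isListed_of_common_neighbor_aux {V : Type*} {G : SimpleGraph V}
    (hT : ∀ a b c, G.Adj a b → G.Adj b c → ¬ G.Adj a c) (hG : HasDominatingPartners G)
    (hU : ∀ v, ∃ u, u ≠ v ∧ ¬ G.Adj u v) {v w x y : V} (hwv : w ≠ v) (hvw : ¬ G.Adj v w)
    (hD : ∀ u, u = v ∨ u = w ∨ G.Adj u v ∨ G.Adj u w) (hxv : G.Adj x v) (hxw : G.Adj x w)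
    (hyx : y ≠ x) (hxy : ¬ G.Adj x y) (hDx : ∀ u, u = x ∨ u = y ∨ G.Adj u x ∨ G.Adj u y)
    (hyv : G.Adj y v) : IsListed G := by
  have hs := fun a b => G.adj_comm a b
  have hxv' := hxv.ne
  have hxw' := hxw.ne
  have hyv' := hyv.ne
  have hyw' : y ≠ w := by rintro rfl; exact hxy hxw
  -- A further neighbour of `x` would be adjacent to `v` or `w`, closing a triangle with `x`.
  have hNx : ∀ u, G.Adj u x → u = v ∨ u = w := by grind
  unfold IsListed
  by_cases hyw : G.Adj y w
  · have : Nonempty (G ≃g cycleGraph 4) := by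
      refine nonempty_iso_of_bijective ![v, x, w, y] ⟨?_, fun u => ?_⟩ ?_
      · simp [Function.Injective, Fin.forall_fin_succ, *, Ne.symm]
      · have : u = v ∨ u = x ∨ u = w ∨ u = y := by
          have := hD u; have := hDx u; grind
        rcases this with rfl | rfl | rfl | rfl
        exacts [⟨0, rfl⟩, ⟨1, rfl⟩, ⟨2, rfl⟩, ⟨3, rfl⟩]
      · have hwv1 : ¬ G.Adj w v := fun h => hvw h.symm
        have hyx1 : ¬ G.Adj y x := fun h => hxy h.symm
        simp [Fin.forall_fin_succ, cycleGraph_adj, hxv, hxv.symm, hxw, hxw.symm, hyv, hyv.symm,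
          hyw, hyw.symm, hvw, hxy, hwv1, hyx1]
        decide
    tauto
  have hwv1 : ¬ G.Adj w v := fun h => hvw h.symm
  have hyx1 : ¬ G.Adj y x := fun h => hxy h.symm
  have hwy : ¬ G.Adj w y := fun h => hyw h.symm
  by_cases hB : ∀ u, u = v ∨ u = x ∨ u = w ∨ u = y
  · have : Nonempty (G ≃g pathGraph 4) := by
      refine nonempty_iso_of_bijective ![y, v, x, w] ⟨?_, fun u => ?_⟩ ?_
      · simp [Function.Injective, Fin.forall_fin_succ, *, Ne.symm]
      · rcases hB u with rfl | rfl | rfl | rfl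
        exacts [⟨1, rfl⟩, ⟨2, rfl⟩, ⟨3, rfl⟩, ⟨0, rfl⟩]
      · simp [Fin.forall_fin_succ, pathGraph_adj, hxv, hxv.symm, hxw, hxw.symm, hyv, hyv.symm,
          hyw, hwy, hvw, hxy, hwv1, hyx1]
    tauto
  push Not at hB
  -- Any fifth vertex misses `x`, hence is adjacent to `y`, hence misses `v`, hence is adjacent to
  -- `w`.
  obtain ⟨b, hbv, hbx, hbw, hby⟩ := hB
  have hbx1 : ¬ G.Adj b x := by grind
  have hby1 : G.Adj b y := by grind
  have hbv1 : ¬ G.Adj b v := by grind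
  have hbw1 : G.Adj b w := by grind
  have hB : ∀ u, u = v ∨ u = x ∨ u = w ∨ u = y ∨ u = b := by
    rcases hG b with h | ⟨c, hcb, hbc, h⟩
    · obtain ⟨u, hu, hub⟩ := hU b
      exact absurd (h u hu) hub
    · intro u
      -- `w` and `y` are adjacent to `b`, and a second vertex of the same kind as `b` would leave
      -- `x` undominated. A sixth vertex would then be adjacent to neither `b` nor `c`.
      have hc : c = v ∨ c = x := by
        have := hD c; have := hDx c; grind
      have := h u; have := hD u; have := hDx u
      grind
  have : Nonempty (G ≃g cycleGraph 5) := by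
    refine nonempty_iso_of_bijective ![v, x, w, b, y] ⟨?_, fun u => ?_⟩ ?_
    · simp [Function.Injective, Fin.forall_fin_succ, *, Ne.symm]
    · rcases hB u with rfl | rfl | rfl | rfl | rfl
      exacts [⟨0, rfl⟩, ⟨1, rfl⟩, ⟨2, rfl⟩, ⟨4, rfl⟩, ⟨3, rfl⟩]
    · have hxb1 : ¬ G.Adj x b := fun h => hbx1 h.symm
      have hvb1 : ¬ G.Adj v b := fun h => hbv1 h.symm
      simp [Fin.forall_fin_succ, cycleGraph_adj, hxv, hxv.symm, hxw, hxw.symm, hyv, hyv.symm,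
        hyw, hwy, hvw, hxy, hwv1, hyx1, hbx1, hxb1, hbv1, hvb1, hby1, hby1.symm, hbw1, hbw1.symm]
      decide
  tauto

theorem isListed_of_common_neighbor {V : Type*} {G : SimpleGraph V}
    (hT : ∀ a b c, G.Adj a b → G.Adj b c → ¬ G.Adj a c) (hG : HasDominatingPartners G)
    (hU : ∀ v, ∃ u, u ≠ v ∧ ¬ G.Adj u v) {v w x : V} (hwv : w ≠ v) (hvw : ¬ G.Adj v w)
    (hD : ∀ u, u = v ∨ u = w ∨ G.Adj u v ∨ G.Adj u w) (hxv : G.Adj x v) (hxw : G.Adj x w) :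
    IsListed G := by
  rcases hG x with h | ⟨y, hyx, hxy, hDx⟩
  · obtain ⟨u, hu, hux⟩ := hU x
    exact absurd (h u hu) hux
  · rcases hD y with rfl | rfl | hyv | hyw
    · exact absurd hxv hxy
    · exact absurd hxw hxy
    · exact isListed_of_common_neighbor_aux hT hG hU hwv hvw hD hxv hxw hyx hxy hDx hyv
    · exact isListed_of_common_neighbor_aux hT hG hU hwv.symm (fun h => hvw h.symm)
        (fun u => by have := hD u; tauto) hxw hxv hyx hxy hDx hyw

/-! ### No dominating pair with a common neighbour -/

theorem nonempty_iso_K1_sum_K2 {V : Type*} {G : SimpleGraph V} {w v a : V} (hwv : w ≠ v)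
    (hwa : w ≠ a) (hva : G.Adj v a) (h1 : ¬ G.Adj w v) (h2 : ¬ G.Adj w a)
    (h : ∀ u, u = w ∨ u = v ∨ u = a) :
    Nonempty (G ≃g (completeGraph (Fin 1) ⊕g completeGraph (Fin 2))) := by
  have h1' : ¬ G.Adj v w := fun h => h1 h.symm
  have h2' : ¬ G.Adj a w := fun h => h2 h.symm
  refine nonempty_iso_of_bijective (Sum.elim ![w] ![v, a]) ⟨?_, fun u => ?_⟩ ?_
  · simp [Function.Injective, Fin.forall_fin_succ, hwv, hwv.symm, hwa, hwa.symm, hva.ne, hva.ne']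
  · rcases h u with rfl | rfl | rfl
    exacts [⟨.inl 0, rfl⟩, ⟨.inr 0, rfl⟩, ⟨.inr 1, rfl⟩]
  · simp [Fin.forall_fin_succ, hva, hva.symm, h1, h2, h1', h2']

/-- A partner of `a` is not `v` and, lacking common neighbours with `a`, is not adjacent to `v`. So
it is adjacent to `w`, as wanted, or is `w` itself. The latter forces N(v) = {a}, and the graph is
2K2 or K1 ∪ K2. -/
theorem exists_partner_adj {V : Type*} {G : SimpleGraph V}
    (hT : ∀ a b c, G.Adj a b → G.Adj b c → ¬ G.Adj a c)
    (hG : ∀ v, ∃ w, w ≠ v ∧ ¬ G.Adj v w ∧ ∀ u, u = v ∨ u = w ∨ G.Adj u v ∨ G.Adj u w)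
    (hC : ∀ v w, w ≠ v → ¬ G.Adj v w → (∀ u, u = v ∨ u = w ∨ G.Adj u v ∨ G.Adj u w) →
      ∀ x, G.Adj x v → ¬ G.Adj x w)
    (hK : ¬ Nonempty (G ≃g (completeGraph (Fin 1) ⊕g completeGraph (Fin 2)))) {v w : V}
    (hwv : w ≠ v) (hvw : ¬ G.Adj v w) (hD : ∀ u, u = v ∨ u = w ∨ G.Adj u v ∨ G.Adj u w) {a : V}
    (ha : G.Adj a v) :
    ∃ b, G.Adj b w ∧ ¬ G.Adj a b ∧ ∀ u, u = a ∨ u = b ∨ G.Adj u a ∨ G.Adj u b := by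
  have hs := fun a b => G.adj_comm a b
  have hvw' := hC v w hwv hvw hD
  obtain ⟨c, hca, hac, h⟩ := hG a
  have h' := hC a c hca hac h
  by_cases hcw : c = w
  · subst hcw
    have hA : ∀ u, G.Adj u v → u = a := fun u hu => by
      have := h u; have := hvw' u; have := hT u a v; grind
    by_cases hB : ∃ b, G.Adj b c
    · obtain ⟨b, hb⟩ := hB
      have hab : ¬ G.Adj a b := fun hab => h' b hab.symm hb
      have hbv : ¬ G.Adj b v := fun h => hvw' b h hb
      refine ⟨b, hb, hab, ?_⟩
      -- The partner of `b` is `v` or `a`; either way a second neighbour of `c` would go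
      -- undominated, so the graph is 2K2.
      obtain ⟨d, hdb, hbd, hbD⟩ := hG b
      have hdc : ¬ G.Adj d c := fun hd => hC b d hdb hbd hbD c hb.symm hd.symm
      have hd : d = v ∨ d = a := by
        have := hD d; have := hA d; grind
      have hBb : ∀ u, G.Adj u c → u = b := fun u hu => by
        have := hbD u; have := hvw' u; have := h' u; have := hT u b c; grind
      intro u
      have := hD u; have := hA u; have := hBb u
      grind
    · exfalso
      push Not at hB
      refine hK (nonempty_iso_K1_sum_K2 (w := c) (v := v) (a := a) hwv hca ha.symm
        (fun h => hvw h.symm) (fun h => hac h.symm) fun u => ?_)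
      have := hD u; have := hA u; have := hB u
      grind
  · refine ⟨c, ?_, hac, h⟩
    have := hD c; have := h' v ha.symm
    grind

theorem isListed_of_no_common_neighbor {V : Type*} [Finite V] [Nonempty V] {G : SimpleGraph V}
    (hT : ∀ a b c, G.Adj a b → G.Adj b c → ¬ G.Adj a c)
    (hG : ∀ v, ∃ w, w ≠ v ∧ ¬ G.Adj v w ∧ ∀ u, u = v ∨ u = w ∨ G.Adj u v ∨ G.Adj u w)
    (hC : ∀ v w, w ≠ v → ¬ G.Adj v w → (∀ u, u = v ∨ u = w ∨ G.Adj u v ∨ G.Adj u w) →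
      ∀ x, G.Adj x v → ¬ G.Adj x w) : IsListed G := by
  obtain ⟨v⟩ := ‹Nonempty V›
  obtain ⟨w, hwv, hvw, hD⟩ := hG v
  have hs := fun a b => G.adj_comm a b
  by_cases hK : Nonempty (G ≃g (completeGraph (Fin 1) ⊕g completeGraph (Fin 2)))
  · unfold IsListed; tauto
  have hvw' := hC v w hwv hvw hD
  have hA : ∀ a, G.Adj a v → ∃ b, G.Adj b w ∧ ¬ G.Adj a b ∧
      ∀ u, u = a ∨ u = b ∨ G.Adj u a ∨ G.Adj u b := fun a ha =>
    exists_partner_adj hT hG hC hK hwv hvw hD ha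
  have hB : ∀ b, G.Adj b w → ∃ a, G.Adj a v ∧ ¬ G.Adj b a ∧
      ∀ u, u = b ∨ u = a ∨ G.Adj u b ∨ G.Adj u a := fun b hb =>
    exists_partner_adj hT hG hC hK hwv.symm (fun h => hvw h.symm)
      (fun u => by have := hD u; tauto) hb
  -- The two sides, {v} ∪ N(w) and {w} ∪ N(v), are complementary.
  have hN : ∀ x, ¬ (x = v ∨ G.Adj x w) ↔ x = w ∨ G.Adj x v := fun x => by
    have := hD x; have := hvw' x; have := G.loopless.irrefl w; grind
  have : Nonempty {x // x = v ∨ G.Adj x w} := ⟨⟨v, Or.inl rfl⟩⟩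
  obtain ⟨e⟩ := nonempty_iso_crownGraph (G := G) (fun x => x = v ∨ G.Adj x w)
    (fun x y hx hy hxy => by
      have := hvw' x; have := hvw' y; have := hT x y w; have := hxy.ne; grind)
    (fun x y hx hy hxy => by
      rw [hN] at hx hy
      have := hvw' x; have := hvw' y; have := hT x y v; have := hxy.ne; grind)
    (fun x hx => by
      simp only [hN]
      rcases hx with rfl | hx
      · exact ⟨w, ⟨Or.inl rfl, hvw⟩, fun y hy => by grind⟩
      -- Another neighbour of `v` is not adjacent to `a`, since N(v) is independent, so domination
      -- makes it adjacent to `x`. This gives uniqueness.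
      · obtain ⟨a, ha, hxa, h⟩ := hB x hx
        refine ⟨a, ⟨Or.inr ha, hxa⟩, fun y hy => ?_⟩
        have := h y; have := hT y a v; have := hvw' x; grind)
    (fun x hx => by
      rw [hN] at hx
      rcases hx with rfl | hx
      · exact ⟨v, ⟨Or.inl rfl, fun h => hvw h.symm⟩, fun y hy => by grind⟩
      · obtain ⟨a, ha, hxa, h⟩ := hA x hx
        refine ⟨a, ⟨Or.inr ha, hxa⟩, fun y hy => ?_⟩
        have := h y; have := hT y a w; have := hvw' x; grind)
  exact isListed_of_iso_crownGraph e

theorem mainTheorem2 {V : Type*} [Fintype V] [DecidableEq V] [Nonempty V]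
    (G : SimpleGraph V) (hG : G.CliqueFree 3) :
    ICNumberEq G (Fintype.card V) ↔
      (Nonempty (G ≃g cycleGraph 4) ∨ Nonempty (G ≃g cycleGraph 5) ∨
        Nonempty (G ≃g cycleGraph 6) ∨
        Nonempty (G ≃g pathGraph 1) ∨ Nonempty (G ≃g pathGraph 2) ∨
        Nonempty (G ≃g pathGraph 3) ∨ Nonempty (G ≃g pathGraph 4) ∨
        Nonempty (G ≃g (completeGraph (Fin 2))ᶜ) ∨
        Nonempty (G ≃g (completeGraph (Fin 1) ⊕g completeGraph (Fin 2))) ∨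
        Nonempty (G ≃g (completeGraph (Fin 2) ⊕g completeGraph (Fin 2))) ∨
        Nonempty (G ≃g graphK0) ∨
        ∃ k : ℕ, 1 ≤ k ∧ Nonempty (G ≃g graphK k)) := by
  rw [icNumberEq_card_iff]
  refine ⟨fun h => ?_, HasDominatingPartners.of_isListed⟩
  have hT : ∀ a b c, G.Adj a b → G.Adj b c → ¬ G.Adj a c := fun a b c hab hbc hac =>
    hG {a, b, c} (SimpleGraph.is3Clique_triple_iff.2 ⟨hab, hac, hbc⟩)
  change IsListed G
  by_cases hU : ∀ v, ∃ u, u ≠ v ∧ ¬ G.Adj u v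
  · have hP : ∀ v, ∃ w, w ≠ v ∧ ¬ G.Adj v w ∧ ∀ u, u = v ∨ u = w ∨ G.Adj u v ∨ G.Adj u w := by
      intro v
      rcases h v with hv | hv
      · obtain ⟨u, hu, huv⟩ := hU v
        exact absurd (hv u hu) huv
      · exact hv
    by_cases hC : ∀ v w, w ≠ v → ¬ G.Adj v w →
      (∀ u, u = v ∨ u = w ∨ G.Adj u v ∨ G.Adj u w) → ∀ x, G.Adj x v → ¬ G.Adj x w
    · exact isListed_of_no_common_neighbor hT hP hC
    · push Not at hC
      obtain ⟨v, w, hwv, hvw, hD, x, hxv, hxw⟩ := hC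
      exact isListed_of_common_neighbor hT h hU hwv hvw hD hxv hxw
  · push Not at hU
    obtain ⟨v, hv⟩ := hU
    exact isListed_of_universal hT h hv
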